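/- Fix a weight \(w\ge 0\) and Hodge numbers \(h^{w-i,i}\) with \(h^{w-i,i}=h^{i,w-i}\) (\(0\le i\le w\)). Consider complex block matrices \(Y=(Y_{i,j})_{0\le i,j\le w}\), with \(Y_{i,j}\) of size \(h^{w-i,i}\times h^{w-j,j}\), let \(Q=\sum_{i=0}^{w}(-1)^iI[i,w-i]\) (identity blocks with these signs on the antidiagonal), let \(\mathfrak g^-\) be the Lie algebra of strictly block lower triangular \(X\) with \(X^tQ+QX=0\), and let \(G^-=\exp(\mathfrak g^-)\). Let \(W\) be the complex manifold of all systems of blocks \((Y_{i,j})_{i\le j+2}\) of elements \(Y\in G^-\) (the blocks with \(i>j+2\) being replaced by \(0\)). The coupled contact system on \(W\) is given by the entries of the matrices of 1-forms \(dY_{j+2,j}-Y_{j+2,j+1}\,dY_{j+1,j}\), \(0\le j\le w-2\). An integral manifold of a system of holomorphic 1-forms on a complex manifold \(M\) is a holomorphic map \(f:S\to M\) from a complex manifold \(S\) such that \(f^*\theta=0\) for all the 1-forms \(\theta\) of the system; two integral manifolds through a point define the same germ there if their images agree in a neighbourhood of that point. a) Let \(w=2k+1\) be odd. Let \(R\)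 be the space of all systems of blocks \(Y_{j+1,j}\) \((0\le j\le k)\), \(Y_{j+2,j}\) \((0\le j<k)\) with \(Y_{k+1,k}\) symmetric, with the system given by the entries of \[dY_{j+2,j}-Y_{j+2,j+1}\,dY_{j+1,j},\qquad 0\le j<k.\] b) Let \(w=2k\) be even. Let \(R\) be the space of all systems of blocks \(Y_{j+1,j}\), \(Y_{j+2,j}\) \((0\le j<k)\) with \[Y_{k+1,k-1}+Y_{k+1,k-1}^t=Y_{k,k-1}^tY_{k,k-1},\] with the system given by the entries of \[dY_{j+2,j}-Y_{j+2,j+1}\,dY_{j+1,j}\quad(0\le j<k-1)\qquad\text{and}\qquad dY_{k+1,k-1}-Y_{k,k-1}^t\,dY_{k,k-1}.\] (For \(k=0\) there are no blocks, no conditions and no forms.) In both cases let \(\pi:W\to R\) be the map that forgets the remaining blocks. Then \(f\mapsto\pi\circ f\) takes integral manifolds of the coupled contact system on \(W\) to integral manifolds of the system on \(R\) and induces a one-to-one correspondence between germs of integral manifolds of the two systems (at all points of \(W\) and of \(R\)). In both directions this correspondence takes germs of embedded \(n\)-dimensional integral submanifolds to germs of embedded \(n\)-dimensional integral submanifolds.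 -/

import Mathlib

open scoped Manifold ContDiff Topology

namespace ContactReduction

noncomputable section

/-! ## Differential systems, integral manifolds and their germs -/

/-- A differential system given by holomorphic 1-forms on an (embedded) complex submanifold
`carrier` of a complex vector space `E`; the 1-forms are written as 1-forms of the ambient space
and are to be restricted to `carrier`. -/
structure DiffSystem (E : Type) [NormedAddCommGroup E] [NormedSpace ℂ E] where
  carrier : Set E
  forms : Set (E → (E →L[ℂ] ℂ))

section General

variable {E : Type} [NormedAddCommGroup E] [NormedSpace ℂ E]
variable {F : Type} [NormedAddCommGroup F] [NormedSpace ℂ F]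

/-- `f : S → E` is an integral manifold of the system `D`: it is holomorphic, takes values in the
submanifold, and `f^* θ = 0` for every generating 1-form `θ` (and therefore for every form in the
differential ideal generated by these 1-forms, as `f^*` commutes with products and with `d`). -/
def DiffSystem.IsIntegral (D : DiffSystem E) (n : ℕ) (S : Type) [TopologicalSpace S]
    [ChartedSpace (EuclideanSpace ℂ (Fin n)) S] (f : S → E) : Prop :=
  MDifferentiable 𝓘(ℂ, EuclideanSpace ℂ (Fin n)) 𝓘(ℂ, E) f ∧
  (∀ s, f s ∈ D.carrier) ∧
  ∀ θ ∈ D.forms, ∀ (s : S) (v : TangentSpace 𝓘(ℂ, EuclideanSpace ℂ (Fin n)) s),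
    θ (f s) (mfderiv 𝓘(ℂ, EuclideanSpace ℂ (Fin n)) 𝓘(ℂ, E) f s v) = 0

/-- An integral manifold of `D` with a base point: a complex manifold `S` of some dimension,
a point of `S`, and a holomorphic map on `S` that is an integral manifold of `D`. -/
structure IntegralManifold (D : DiffSystem E) where
  dim : ℕ
  S : Type
  [top : TopologicalSpace S]
  [charted : ChartedSpace (EuclideanSpace ℂ (Fin dim)) S]
  [manifold : IsManifold 𝓘(ℂ, EuclideanSpace ℂ (Fin dim)) ω S]
  [t2 : T2Space S]
  [secondCountable : SecondCountableTopology S]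
  map : S → E
  integral : D.IsIntegral dim S map
  base : S

attribute [instance] IntegralManifold.top IntegralManifold.charted IntegralManifold.manifold
  IntegralManifold.t2 IntegralManifold.secondCountable

/-- The integral manifold `g ∘ f` with the same source and the same base point as `f`. -/
def IntegralManifold.comp {D : DiffSystem E} (M : IntegralManifold D) (g : E → F)
    (D' : DiffSystem F) (h : D'.IsIntegral M.dim M.S (g ∘ M.map)) : IntegralManifold D' where
  dim := M.dim
  S := M.S
  map := g ∘ M.map
  integral := h
  base := M.base

/-- Two integral manifolds through the same point have the same germ there if their images agree
in a neighbourhood of that point. -/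
instance germSetoid (D : DiffSystem E) : Setoid (IntegralManifold D) where
  r M N := M.map M.base = N.map N.base ∧
    ∃ U ∈ 𝓝 (M.map M.base), Set.range M.map ∩ U = Set.range N.map ∩ U
  iseqv := by
    refine ⟨fun M => ⟨rfl, Set.univ, Filter.univ_mem, rfl⟩, ?_, ?_⟩
    · rintro M N ⟨h, U, hU, e⟩
      exact ⟨h.symm, U, h ▸ hU, e.symm⟩
    · rintro M N P ⟨h, U, hU, e⟩ ⟨h', V, hV, e'⟩
      refine ⟨h.trans h', U ∩ V, Filter.inter_mem hU (h ▸ hV), ?_⟩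
      rw [← Set.inter_assoc, e, Set.inter_assoc, Set.inter_comm U V, ← Set.inter_assoc, e',
        Set.inter_assoc]

/-- Germs (at all points) of integral manifolds of `D`. -/
def IntegralGerm (D : DiffSystem E) : Type 1 := Quotient (germSetoid D)

/-- The germ of an integral manifold at (the image of) its base point. -/
def IntegralManifold.germ {D : DiffSystem E} (M : IntegralManifold D) : IntegralGerm D :=
  Quotient.mk (germSetoid D) M

/-- The germ is that of an embedded `n`-dimensional complex submanifold. -/
def IntegralGerm.IsSubmanifold {D : DiffSystem E} (γ : IntegralGerm D) (n : ℕ) : Prop :=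
  ∃ M : IntegralManifold D, M.germ = γ ∧ M.dim = n ∧ Topology.IsEmbedding M.map ∧
    ∀ s, Function.Injective
      (mfderiv 𝓘(ℂ, EuclideanSpace ℂ (Fin M.dim)) 𝓘(ℂ, E) M.map s)

end General

/-! ## Block matrices -/

/-- Hodge numbers of weight `w`: `h i` is `h^{w-i,i}`, for `0 ≤ i ≤ w`, and
`h^{w-i,i} = h^{i,w-i}`. -/
structure HodgeNumbers (w : ℕ) where
  h : Fin (w + 1) → ℕ
  symm : ∀ i, h i.rev = h i

variable {w : ℕ}

/-- Row and column indices of matrices with respect to a Hodge frame: a block `i` together with a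
position inside the block. -/
abbrev HodgeNumbers.Idx (H : HodgeNumbers w) : Type := Σ i : Fin (w + 1), Fin (H.h i)

/-- The same position in the opposite block: block `i` is matched with block `w - i`. -/
def HodgeNumbers.mirror (H : HodgeNumbers w) (a : H.Idx) : H.Idx :=
  ⟨a.1.rev, Fin.cast (H.symm a.1).symm a.2⟩

/-- The matrix of the polarization in a Hodge frame, `Q = ∑ (-1)^i I[i, w-i]`. -/
def HodgeNumbers.Q (H : HodgeNumbers w) : Matrix H.Idx H.Idx ℂ :=
  fun a b => if b = H.mirror a then (-1) ^ (a.1 : ℕ) else 0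

/-- The Lie algebra `𝔤⁻`: the strictly block lower triangular `X` with `Xᵗ Q + Q X = 0`. -/
def HodgeNumbers.gMinus (H : HodgeNumbers w) : Set (Matrix H.Idx H.Idx ℂ) :=
  {X | (∀ a b : H.Idx, a.1 ≤ b.1 → X a b = 0) ∧ X.transpose * H.Q + H.Q * X = 0}

/-- The unipotent group `G⁻` of `𝔤⁻`: the matrices `Y = exp X` with `X = log Y` in `𝔤⁻`
(`X` is nilpotent, so the exponential is a finite sum). -/
def HodgeNumbers.GMinus (H : HodgeNumbers w) : Set (Matrix H.Idx H.Idx ℂ) :=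
  {Y | ∃ X ∈ H.gMinus, Y = IsNilpotent.exp X}

/-- The space of all block matrices `(Y_{i,j})`, as a normed space. -/
abbrev HodgeNumbers.Amb (H : HodgeNumbers w) : Type := H.Idx → H.Idx → ℂ

/-- Keep the blocks `(i, j)` with `P i j` and replace the others by zero. -/
def HodgeNumbers.keep (H : HodgeNumbers w) (P : ℕ → ℕ → Prop) [DecidableRel P] (Y : H.Amb) :
    H.Amb :=
  fun a b => if P a.1 b.1 then Y a b else 0

/-- The coordinate 1-form `dY` of the matrix entry at `(a, b)`. -/
def HodgeNumbers.dY (H : HodgeNumbers w) (a b : H.Idx) : H.Amb →L[ℂ] ℂ :=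
  (ContinuousLinearMap.proj (R := ℂ) (φ := fun _ : H.Idx => ℂ) b).comp
    (ContinuousLinearMap.proj (R := ℂ) (φ := fun _ : H.Idx => H.Idx → ℂ) a)

/-- For `a` in block `i` and `b` in block `j`, the `(a, b)` entry of the matrix of 1-forms
`dY_{i,j} - Y_{i,j+1} dY_{j+1,j}`. -/
def HodgeNumbers.contactForm (H : HodgeNumbers w) (a b : H.Idx) : H.Amb → (H.Amb →L[ℂ] ℂ) :=
  fun Y => H.dY a b -
    ∑ c : H.Idx, if (c.1 : ℕ) = (b.1 : ℕ) + 1 then Y a c • H.dY c b else 0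

/-! ## The coupled contact system and the reduced systems -/

/-- The space `W` of blocks `Y_{i,j}`, `i ≤ j + 2`, of the elements of `G⁻`; the blocks with
`i > j + 2` are set to zero. -/
def HodgeNumbers.W (H : HodgeNumbers w) : Set H.Amb :=
  {Z | ∃ Y ∈ H.GMinus, Z = H.keep (fun i j => i ≤ j + 2) Y}

/-- The coupled contact system on `W`: the entries of `dY_{i,j} - Y_{i,j+1} dY_{j+1,j}` for
`i = j + 2`. -/
def HodgeNumbers.coupledContact (H : HodgeNumbers w) : DiffSystem H.Amb where
  carrier := H.W
  forms := {θ | ∃ a b : H.Idx, (a.1 : ℕ) = b.1 + 2 ∧ θ = H.contactForm a b}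

/-- The blocks of the reduced system of weight `2 k + 1`: `Y_{j+1,j}` for `j ≤ k` and `Y_{j+2,j}`
for `j < k`. -/
abbrev OddBlock (k : ℕ) (i j : ℕ) : Prop := (i = j + 1 ∧ j ≤ k) ∨ (i = j + 2 ∧ j < k)

/-- The blocks of the reduced system of weight `2 k`: `Y_{j+1,j}` and `Y_{j+2,j}` for `j < k`. -/
abbrev EvenBlock (k : ℕ) (i j : ℕ) : Prop := (i = j + 1 ∧ j < k) ∨ (i = j + 2 ∧ j < k)

/-- The reduced system of weight `2 k + 1`, in the blocks `OddBlock k`, with `Y_{k+1,k}`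
symmetric: the entries of `dY_{j+2,j} - Y_{j+2,j+1} dY_{j+1,j}` for `j < k`. -/
def oddReduced (k : ℕ) (H : HodgeNumbers (2 * k + 1)) : DiffSystem H.Amb where
  carrier := {Y | (∀ a b : H.Idx, ¬ OddBlock k a.1 b.1 → Y a b = 0) ∧
    ∀ a b : H.Idx, (a.1 : ℕ) = k + 1 → (b.1 : ℕ) = k → Y (H.mirror b) (H.mirror a) = Y a b}
  forms := {θ | ∃ a b : H.Idx, (a.1 : ℕ) = b.1 + 2 ∧ (b.1 : ℕ) < k ∧ θ = H.contactForm a b}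

/-- For weight `2 k`, `a` in block `k + 1` and `b` in block `k - 1`, the `(a, b)` entry of
`dY_{k+1,k-1} - Y_{k,k-1}ᵗ dY_{k,k-1}`. -/
def middleForm (k : ℕ) (H : HodgeNumbers (2 * k)) (a b : H.Idx) : H.Amb → (H.Amb →L[ℂ] ℂ) :=
  fun Y => H.dY a b - ∑ c : H.Idx, if (c.1 : ℕ) = k then Y c (H.mirror a) • H.dY c b else 0

/-- The reduced system of weight `2 k`, in the blocks `EvenBlock k`, subject to
`Y_{k+1,k-1} + Y_{k+1,k-1}ᵗ = Y_{k,k-1}ᵗ Y_{k,k-1}`: the entries of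
`dY_{j+2,j} - Y_{j+2,j+1} dY_{j+1,j}` for `j < k - 1` and of
`dY_{k+1,k-1} - Y_{k,k-1}ᵗ dY_{k,k-1}`. -/
def evenReduced (k : ℕ) (H : HodgeNumbers (2 * k)) : DiffSystem H.Amb where
  carrier := {Y | (∀ a b : H.Idx, ¬ EvenBlock k a.1 b.1 → Y a b = 0) ∧
    ∀ a b : H.Idx, (a.1 : ℕ) = k + 1 → (b.1 : ℕ) + 1 = k →
      Y a b + Y (H.mirror b) (H.mirror a) =
        ∑ c : H.Idx, if (c.1 : ℕ) = k then Y c (H.mirror a) * Y c b else 0}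
  forms :=
    {θ | ∃ a b : H.Idx, (a.1 : ℕ) = b.1 + 2 ∧ (b.1 : ℕ) + 1 < k ∧ θ = H.contactForm a b} ∪
    {θ | ∃ a b : H.Idx, (a.1 : ℕ) = k + 1 ∧ (b.1 : ℕ) + 1 = k ∧ θ = middleForm k H a b}

/-- The map `π` induces a one-to-one correspondence between germs of integral manifolds of `D` and
of `D'`: there is a bijection that sends the germ of `f` at a point to the germ of `π ∘ f`, and in
both directions it preserves germs of `n`-dimensional submanifolds. -/
def InducesGermCorrespondence {E F : Type} [NormedAddCommGroup E] [NormedSpace ℂ E]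
    [NormedAddCommGroup F] [NormedSpace ℂ F] (π : E → F) (D : DiffSystem E) (D' : DiffSystem F) :
    Prop :=
  ∃ Φ : IntegralGerm D ≃ IntegralGerm D',
    (∀ M : IntegralManifold D, ∃ hM : D'.IsIntegral M.dim M.S (π ∘ M.map),
      Φ M.germ = (M.comp π D' hM).germ) ∧
    ∀ (γ : IntegralGerm D) (n : ℕ), γ.IsSubmanifold n ↔ (Φ γ).IsSubmanifold n

end

end ContactReduction

open ContactReduction

namespace ContactReduction

noncomputable section

/-! ### Germs of integral manifolds under maps that are invertible on the carrier. -/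

section General

variable {E : Type} [NormedAddCommGroup E] [NormedSpace ℂ E]
variable {F : Type} [NormedAddCommGroup F] [NormedSpace ℂ F]

/-! Write an element of `G⁻` as `exp X`. Down to the second subdiagonal it is `1 + X₁ + (X₂ +
X₁²/2)`, and membership of `X` in `𝔤⁻` says that `X₁` is symmetric and `X₂` antisymmetric under
transposition along the antidiagonal (`mirror`). Hence `W` is cut out by two relations
(`mem_W_iff`): the first subdiagonal of `Y` is mirror symmetric, and a block of the second plus its
mirror image is `Y_{j+2,j+1} Y_{j+1,j}`. Half of the blocks, subject to the relation in the middle,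
therefore determine a point of `W` polynomially (`complete`).

Differentiating the second relation shows that mirror contact forms are negatives of each other on
`W` (`contactForm_mirror`), so those past the middle are redundant; the one in the middle is
rewritten by symmetry. Projection and completion then match points and integral elements, and
`inducesGermCorrespondence_of_inverse` passes to germs. `IsZariskiTangent` supplies the
differentiated relations without a manifold structure on `W`. -/

/-- `u` is annihilated by the differentials at `y` of all functions vanishing on `C`. -/
def IsZariskiTangent (C : Set E) (y u : E) : Prop :=
  ∀ r : E → ℂ, Differentiable ℂ r → (∀ z ∈ C, r z = 0) → fderiv ℂ r y u = 0

variable {n : ℕ} {S : Type} [TopologicalSpace S] [ChartedSpace (EuclideanSpace ℂ (Fin n)) S]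

lemma mfderiv_comp_apply_of_differentiable {f : S → E} {g : E → F}
    (hf : MDifferentiable 𝓘(ℂ, EuclideanSpace ℂ (Fin n)) 𝓘(ℂ, E) f) (hg : Differentiable ℂ g)
    (s : S) (v : TangentSpace 𝓘(ℂ, EuclideanSpace ℂ (Fin n)) s) :
    mfderiv 𝓘(ℂ, EuclideanSpace ℂ (Fin n)) 𝓘(ℂ, F) (g ∘ f) s v =
      fderiv ℂ g (f s) (mfderiv 𝓘(ℂ, EuclideanSpace ℂ (Fin n)) 𝓘(ℂ, E) f s v) := by
  rw [mfderiv_comp s (hg (f s)).mdifferentiableAt (hf s), mfderiv_eq_fderiv]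
  rfl

/-- A function vanishing on `C` becomes identically zero after composition with `f`; the chain rule
does the rest. -/
lemma isZariskiTangent_mfderiv {C : Set E} {f : S → E}
    (hf : MDifferentiable 𝓘(ℂ, EuclideanSpace ℂ (Fin n)) 𝓘(ℂ, E) f) (hC : ∀ s, f s ∈ C)
    (s : S) (v : TangentSpace 𝓘(ℂ, EuclideanSpace ℂ (Fin n)) s) :
    IsZariskiTangent C (f s)
      (mfderiv 𝓘(ℂ, EuclideanSpace ℂ (Fin n)) 𝓘(ℂ, E) f s v) := by
  intro r hr hz
  rw [← mfderiv_comp_apply_of_differentiable hf hr]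
  have : r ∘ f = fun _ => (0 : ℂ) := funext fun s => hz _ (hC s)
  rw [this, mfderiv_const]
  rfl

lemma differentiable_comp_mdifferentiable {f : S → E} {g : E → F}
    (hf : MDifferentiable 𝓘(ℂ, EuclideanSpace ℂ (Fin n)) 𝓘(ℂ, E) f) (hg : Differentiable ℂ g) :
    MDifferentiable 𝓘(ℂ, EuclideanSpace ℂ (Fin n)) 𝓘(ℂ, F) (g ∘ f) :=
  hg.mdifferentiable.comp hf

/-- Composition with a continuous map that has a continuous left inverse on the carrier respects
equality of germs. -/
lemma germ_comp_eq {D : DiffSystem E} {D' : DiffSystem F} {g : E → F} {g' : F → E}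
    (hg' : Continuous g') (h : ∀ y ∈ D.carrier, g' (g y) = y)
    {M N : IntegralManifold D} (hM : D'.IsIntegral M.dim M.S (g ∘ M.map))
    (hN : D'.IsIntegral N.dim N.S (g ∘ N.map)) (hMN : germSetoid D M N) :
    germSetoid D' (M.comp g D' hM) (N.comp g D' hN) := by
  obtain ⟨e, U, hU, hr⟩ := hMN
  -- Since `g'` undoes `g` on the carrier, a point `g y` lies in this neighbourhood exactly when `y`
  -- lies in `U`.
  refine ⟨congrArg g e, g' ⁻¹' U, ?_, ?_⟩
  · refine hg'.continuousAt.preimage_mem_nhds ?_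
    change U ∈ 𝓝 (g' (g (M.map M.base)))
    rwa [h _ (M.integral.2.1 _)]
  · have key : ∀ (A B : IntegralManifold D), Set.range A.map ∩ U = Set.range B.map ∩ U →
        ∀ x, x ∈ Set.range (g ∘ A.map) ∩ g' ⁻¹' U → x ∈ Set.range (g ∘ B.map) ∩ g' ⁻¹' U := by
      rintro A B hAB _ ⟨⟨s, rfl⟩, hx⟩
      have hx' : A.map s ∈ U := by
        have : g' (g (A.map s)) ∈ U := hx
        rwa [h _ (A.integral.2.1 _)] at this
      have : A.map s ∈ Set.range B.map ∩ U := hAB ▸ ⟨⟨s, rfl⟩, hx'⟩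
      obtain ⟨⟨t, ht⟩, -⟩ := this
      exact ⟨⟨t, congrArg g ht⟩, hx⟩
    exact Set.Subset.antisymm (key M N hr) (key N M hr.symm)

/-- Composition with a differentiable map that has a differentiable left inverse on the carrier
takes germs of embedded submanifolds to germs of embedded submanifolds. -/
lemma isSubmanifold_germ_comp {D : DiffSystem E} {D' : DiffSystem F} {g : E → F} {g' : F → E}
    (dg : Differentiable ℂ g) (dg' : Differentiable ℂ g') (h : ∀ y ∈ D.carrier, g' (g y) = y)
    {M : IntegralManifold D} (hM : D'.IsIntegral M.dim M.S (g ∘ M.map))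
    (he : Topology.IsEmbedding M.map)
    (hi : ∀ s, Function.Injective
      (mfderiv 𝓘(ℂ, EuclideanSpace ℂ (Fin M.dim)) 𝓘(ℂ, E) M.map s)) :
    (M.comp g D' hM).germ.IsSubmanifold M.dim := by
  -- Being an embedding and having injective differentials both pass from this composite to its
  -- first factor `g ∘ M.map`.
  have hid : g' ∘ (g ∘ M.map) = M.map := funext fun s => h _ (M.integral.2.1 s)
  refine ⟨_, rfl, rfl, ?_, ?_⟩
  · refine Topology.IsEmbedding.of_comp (g := g') (dg.continuous.comp he.continuous)
      dg'.continuous ?_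
    exact hid ▸ he
  · have key : ∀ (s : M.S) (v : TangentSpace 𝓘(ℂ, EuclideanSpace ℂ (Fin M.dim)) s),
        mfderiv 𝓘(ℂ, EuclideanSpace ℂ (Fin M.dim)) 𝓘(ℂ, E) M.map s v =
        fderiv ℂ g' (g (M.map s))
          (mfderiv 𝓘(ℂ, EuclideanSpace ℂ (Fin M.dim)) 𝓘(ℂ, F) (g ∘ M.map) s v) := by
      intro s v
      have := mfderiv_comp_apply_of_differentiable hM.1 dg' s v
      rw [hid] at this
      exact this
    have inj : ∀ s : M.S, Function.Injective
        (mfderiv 𝓘(ℂ, EuclideanSpace ℂ (Fin M.dim)) 𝓘(ℂ, F) (g ∘ M.map) s) := by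
      intro s v v' hv
      exact hi s (by rw [key, key, hv])
    exact inj

/-- A linear projection that restricts to a bijection of the carriers, with differentiable inverse,
and under which the two systems have the same integral elements induces a correspondence of germs
of integral manifolds. -/
theorem inducesGermCorrespondence_of_inverse {D : DiffSystem E} {D' : DiffSystem F}
    (P : E →L[ℂ] F) (σ : F → E) (dσ : Differentiable ℂ σ)
    (hP : ∀ y ∈ D.carrier, P y ∈ D'.carrier) (hσ : ∀ x ∈ D'.carrier, σ x ∈ D.carrier)
    (hσP : ∀ y ∈ D.carrier, σ (P y) = y) (hPσ : ∀ x ∈ D'.carrier, P (σ x) = x)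
    (hforms : ∀ y ∈ D.carrier, ∀ u, IsZariskiTangent D.carrier y u →
      ((∀ θ ∈ D.forms, θ y u = 0) ↔ ∀ θ ∈ D'.forms, θ (P y) (P u) = 0)) :
    InducesGermCorrespondence P D D' := by
  have I1 : ∀ M : IntegralManifold D, D'.IsIntegral M.dim M.S (P ∘ M.map) := by
    intro M
    refine ⟨differentiable_comp_mdifferentiable M.integral.1 P.differentiable,
      fun s => hP _ (M.integral.2.1 s), fun θ hθ s v => ?_⟩
    rw [mfderiv_comp_apply_of_differentiable M.integral.1 P.differentiable,
      ContinuousLinearMap.fderiv]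
    exact (hforms _ (M.integral.2.1 s) _
      (isZariskiTangent_mfderiv M.integral.1 M.integral.2.1 s v)).1
      (fun θ hθ => M.integral.2.2 θ hθ s v) θ hθ
  have I2 : ∀ M : IntegralManifold D', D.IsIntegral M.dim M.S (σ ∘ M.map) := by
    intro M
    have hd := differentiable_comp_mdifferentiable M.integral.1 dσ
    have hc : ∀ s, (σ ∘ M.map) s ∈ D.carrier := fun s => hσ _ (M.integral.2.1 s)
    have hid : P ∘ (σ ∘ M.map) = M.map := funext fun s => hPσ _ (M.integral.2.1 s)
    refine ⟨hd, hc, fun θ hθ s v => ?_⟩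
    -- The vector is the differential of `σ ∘ M.map`; its image under `P` is the differential of
    -- `M.map`, on which the forms of `D'` vanish.
    refine (hforms _ (hc s) _ (isZariskiTangent_mfderiv hd hc s v)).2 (fun θ hθ => ?_) θ hθ
    have := mfderiv_comp_apply_of_differentiable hd P.differentiable s v
    rw [hid, ContinuousLinearMap.fderiv] at this
    have h1 : P ((σ ∘ M.map) s) = M.map s := congrFun hid s
    rw [h1]
    have h2 := M.integral.2.2 θ hθ s v
    rw [this] at h2
    exact h2
  let Φ : IntegralGerm D ≃ IntegralGerm D' :=
    { toFun := Quotient.map (fun M => M.comp P D' (I1 M))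
        (fun M N h => germ_comp_eq dσ.continuous hσP _ _ h)
      invFun := Quotient.map (fun M => M.comp σ D (I2 M))
        (fun M N h => germ_comp_eq P.continuous hPσ _ _ h)
      left_inv := by
        rintro ⟨M⟩
        refine Quotient.sound ⟨hσP _ (M.integral.2.1 _), Set.univ, Filter.univ_mem, ?_⟩
        congr 2
        exact funext fun s => hσP _ (M.integral.2.1 s)
      right_inv := by
        rintro ⟨M⟩
        refine Quotient.sound ⟨hPσ _ (M.integral.2.1 _), Set.univ, Filter.univ_mem, ?_⟩
        congr 2
        exact funext fun s => hPσ _ (M.integral.2.1 s) }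
  refine ⟨Φ, fun M => ⟨I1 M, rfl⟩, fun γ n => ⟨?_, ?_⟩⟩
  · rintro ⟨M, rfl, rfl, he, hi⟩
    exact isSubmanifold_germ_comp P.differentiable dσ hσP (I1 M) he hi
  · rintro ⟨M, hM, rfl, he, hi⟩
    have : γ = Φ.symm M.germ := by rw [hM, Equiv.symm_apply_apply]
    rw [this]
    exact isSubmanifold_germ_comp dσ P.differentiable hPσ (I2 M) he hi

end General


variable {w : ℕ}

namespace HodgeNumbers

variable (H : HodgeNumbers w)

/-! ### The mirror involution -/

lemma mirror_fst_add (a : H.Idx) : ((H.mirror a).1 : ℕ) + a.1 = w := by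
  have := a.1.isLt
  simp only [mirror, Fin.val_rev]
  omega

lemma mirror_eq_of_fst_rev {a : H.Idx} (h : a.1.rev = a.1) : H.mirror a = a :=
  Sigma.ext h (by
    obtain ⟨i, x⟩ := a
    refine (Fin.heq_ext_iff ?_).2 rfl
    exact congrArg H.h h)

lemma mirror_mirror (a : H.Idx) : H.mirror (H.mirror a) = a :=
  Sigma.ext (Fin.rev_rev _) (by
    obtain ⟨i, x⟩ := a
    refine (Fin.heq_ext_iff ?_).2 rfl
    exact congrArg H.h (Fin.rev_rev _))

/-- Positions inside the middle block are fixed as well, so the mirror of a product through that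
block involves ordinary transposes. -/
lemma mirror_eq_self {a : H.Idx} (h : 2 * (a.1 : ℕ) = w) : H.mirror a = a :=
  H.mirror_eq_of_fst_rev (Fin.ext (by simp only [Fin.val_rev]; omega))

/-- The mirror involution as a permutation of the indices. -/
def mirrorEquiv : H.Idx ≃ H.Idx := ⟨H.mirror, H.mirror, H.mirror_mirror, H.mirror_mirror⟩

lemma sum_mirror (f : H.Idx → ℂ) : ∑ c, f (H.mirror c) = ∑ c, f c :=
  H.mirrorEquiv.sum_comp f

/-! ### Products of the blocks next to the diagonal -/

/-- The entries of the products `U_{i,j+1} Z_{j+1,j}`. -/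
def stepMul (U Z : H.Amb) (a b : H.Idx) : ℂ :=
  ∑ c : H.Idx, if (c.1 : ℕ) = (b.1 : ℕ) + 1 then U a c * Z c b else 0

variable {H}

/-- Transposition reverses products, so `U` and `Z` change places; the middle index is reindexed by
the mirror. -/
lemma stepMul_mirror {U Z : H.Amb}
    (hU : ∀ a b : H.Idx, (a.1 : ℕ) = b.1 + 1 → U (H.mirror b) (H.mirror a) = U a b)
    (hZ : ∀ a b : H.Idx, (a.1 : ℕ) = b.1 + 1 → Z (H.mirror b) (H.mirror a) = Z a b)
    {a b : H.Idx} (hab : (a.1 : ℕ) = b.1 + 2) :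
    H.stepMul U Z (H.mirror b) (H.mirror a) = H.stepMul Z U a b := by
  unfold stepMul
  rw [← H.sum_mirror]
  refine Finset.sum_congr rfl fun c _ => ?_
  have h1 := H.mirror_fst_add a
  have h2 := H.mirror_fst_add c
  by_cases hc : (c.1 : ℕ) = b.1 + 1
  · rw [if_pos (by omega), if_pos hc, hU _ _ hc, hZ _ _ (by omega), mul_comm]
  · rw [if_neg (by omega), if_neg hc]

lemma stepMul_congr {U U' Z Z' : H.Amb} {a b : H.Idx} (hab : (a.1 : ℕ) = b.1 + 2)
    (hU : ∀ a b : H.Idx, (a.1 : ℕ) = b.1 + 1 → U a b = U' a b)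
    (hZ : ∀ a b : H.Idx, (a.1 : ℕ) = b.1 + 1 → Z a b = Z' a b) :
    H.stepMul U Z a b = H.stepMul U' Z' a b := by
  refine Finset.sum_congr rfl fun c _ => ?_
  split_ifs with hc
  · rw [hU _ _ (by omega), hZ _ _ hc]
  · rfl

/-! ### The Lie algebra and the exponential -/

/-- `Q` is a signed permutation matrix, so each product contributes a single term. The weight enters
the sign twice and cancels: in either parity the first subdiagonal is mirror symmetric and the
second antisymmetric. -/
lemma mem_gMinus_iff (X : Matrix H.Idx H.Idx ℂ) :
    X ∈ H.gMinus ↔ (∀ a b : H.Idx, a.1 ≤ b.1 → X a b = 0) ∧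
      ∀ a b : H.Idx, X (H.mirror b) (H.mirror a) = -(-1) ^ ((a.1 : ℕ) + b.1) * X a b := by
  have hval : ∀ a b : H.Idx, (X.transpose * H.Q + H.Q * X) a b =
      (-1) ^ ((H.mirror b).1 : ℕ) * X (H.mirror b) a + (-1) ^ (a.1 : ℕ) * X (H.mirror a) b := by
    intro a b
    have hb : ∀ c, b = H.mirror c ↔ c = H.mirror b := fun c =>
      ⟨fun h => by rw [h, mirror_mirror], fun h => by rw [h, mirror_mirror]⟩
    rw [Matrix.add_apply, Matrix.mul_apply, Matrix.mul_apply]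
    simp only [Matrix.transpose_apply, Q, hb]
    simp [mul_comm]
  refine and_congr Iff.rfl ⟨fun h a b => ?_, fun h => ?_⟩
  · have := congrFun (congrFun h (H.mirror a)) b
    rw [hval, mirror_mirror, Matrix.zero_apply] at this
    have ha := H.mirror_fst_add a
    have hb := H.mirror_fst_add b
    have e : ((-1 : ℂ)) ^ ((H.mirror b).1 : ℕ) * (-1) ^ ((H.mirror b).1 : ℕ) = 1 := by
      rw [← pow_add]; exact Even.neg_one_pow ⟨_, rfl⟩
    have e' : ((-1 : ℂ)) ^ ((H.mirror b).1 : ℕ) * (-1) ^ ((H.mirror a).1 : ℕ) =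
        (-1) ^ ((a.1 : ℕ) + b.1) := by
      rw [← pow_add]
      apply neg_one_pow_congr
      simp only [← Nat.not_odd_iff_even, Nat.odd_iff]
      omega
    linear_combination (-1 : ℂ) ^ ((H.mirror b).1 : ℕ) * this - X (H.mirror b) (H.mirror a) * e
      - X a b * e'
  · ext a b
    have hh := h (H.mirror a) b
    rw [mirror_mirror] at hh
    rw [hval, hh, Matrix.zero_apply]
    have ha := H.mirror_fst_add a
    have hb := H.mirror_fst_add b
    have e' : ((-1 : ℂ)) ^ ((H.mirror b).1 : ℕ) * (-1) ^ (((H.mirror a).1 : ℕ) + b.1) =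
        (-1) ^ (a.1 : ℕ) := by
      rw [← pow_add]
      apply neg_one_pow_congr
      simp only [← Nat.not_odd_iff_even, Nat.odd_iff]
      omega
    linear_combination - X (H.mirror a) b * e'

/-- Each factor moves at least one block down. -/
lemma pow_apply_eq_zero {X : Matrix H.Idx H.Idx ℂ} (hX : ∀ a b : H.Idx, a.1 ≤ b.1 → X a b = 0)
    (n : ℕ) : ∀ a b : H.Idx, (a.1 : ℕ) < b.1 + n → (X ^ n) a b = 0 := by
  induction n with
  | zero =>
    intro a b h
    rw [pow_zero, Matrix.one_apply_ne]
    rintro rfl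
    omega
  | succ n ih =>
    intro a b h
    rw [pow_succ, Matrix.mul_apply]
    refine Finset.sum_eq_zero fun c _ => ?_
    by_cases hc : c.1 ≤ b.1
    · rw [hX _ _ hc, mul_zero]
    · rw [ih _ _ (by have : (b.1 : ℕ) < c.1 := not_le.1 hc
                     omega), zero_mul]

/-- Descending two blocks in two nontrivial steps leaves exactly one block for each step. -/
lemma sq_apply_eq_stepMul {X : Matrix H.Idx H.Idx ℂ}
    (hX : ∀ a b : H.Idx, a.1 ≤ b.1 → X a b = 0) {a b : H.Idx} (hab : (a.1 : ℕ) = b.1 + 2) :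
    (X ^ 2) a b = H.stepMul X X a b := by
  rw [sq, Matrix.mul_apply]
  refine Finset.sum_congr rfl fun c _ => ?_
  split_ifs with hc
  · rfl
  · rcases Nat.lt_or_ge b.1 c.1 with h | h
    · rw [hX a c (Fin.le_def.2 (by omega)), zero_mul]
    · rw [hX c b (Fin.le_def.2 h), mul_zero]

lemma exp_apply {X : Matrix H.Idx H.Idx ℂ} (hX : ∀ a b : H.Idx, a.1 ≤ b.1 → X a b = 0)
    {a b : H.Idx} (hab : (a.1 : ℕ) ≤ b.1 + 2) :
    IsNilpotent.exp X a b = (1 : Matrix H.Idx H.Idx ℂ) a b + X a b + (X ^ 2) a b / 2 := by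
  -- The power `w + 1` already vanishes; the surplus lets the sum split as `3 + w` terms in every
  -- weight.
  have h0 : X ^ (w + 3) = 0 := by
    ext a b
    exact pow_apply_eq_zero hX _ a b (by have := a.1.isLt; omega)
  rw [IsNilpotent.exp_eq_sum h0, Matrix.sum_apply, add_comm w 3, Finset.sum_range_add,
    Finset.sum_eq_zero (s := Finset.range w), add_zero]
  · simp [Finset.sum_range_succ, Matrix.smul_apply, Rat.smul_def]
    ring
  · intro i _
    rw [Matrix.smul_apply, pow_apply_eq_zero hX _ a b (by omega), smul_zero]

/-! ### The equations of `W`. -/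

/-- Entrywise equations of the space of blocks `Y_{i,j}`, `i ≤ j + 2`, of `G⁻`. -/
structure IsTruncation (Z : H.Amb) : Prop where
  far : ∀ a b : H.Idx, (b.1 : ℕ) + 2 < a.1 → Z a b = 0
  upper : ∀ a b : H.Idx, (a.1 : ℕ) ≤ b.1 → Z a b = (1 : Matrix H.Idx H.Idx ℂ) a b
  fst : ∀ a b : H.Idx, (a.1 : ℕ) = b.1 + 1 → Z (H.mirror b) (H.mirror a) = Z a b
  snd : ∀ a b : H.Idx, (a.1 : ℕ) = b.1 + 2 →
    Z a b + Z (H.mirror b) (H.mirror a) = H.stepMul Z Z a b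

/-- In `X₂ + X₁²/2` the antisymmetric part `X₂` cancels against its mirror, and the symmetric part
`X₁²/2` doubles. -/
lemma isTruncation_of_mem_W {Z : H.Amb} (hZ : Z ∈ H.W) : IsTruncation Z := by
  obtain ⟨Y, ⟨X, hX, rfl⟩, e⟩ := hZ
  rw [mem_gMinus_iff] at hX
  obtain ⟨hX, hm⟩ := hX
  have hz : ∀ a b : H.Idx, (a.1 : ℕ) ≤ b.1 + 2 →
      Z a b = (1 : Matrix H.Idx H.Idx ℂ) a b + X a b + (X ^ 2) a b / 2 := fun a b h =>
    (congrFun (congrFun e a) b).trans ((if_pos h).trans (exp_apply hX h))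
  have h1 : ∀ a b : H.Idx, (a.1 : ℕ) = b.1 + 1 → Z a b = X a b := by
    intro a b hab
    rw [hz _ _ (by omega), pow_apply_eq_zero hX _ _ _ (by omega),
      Matrix.one_apply_ne (by rintro rfl; omega)]
    ring
  have h2 : ∀ a b : H.Idx, (a.1 : ℕ) = b.1 + 2 →
      Z a b =
        X a b + H.stepMul X X a b / 2 := by
    intro a b hab
    rw [hz _ _ (by omega), sq_apply_eq_stepMul hX hab,
      Matrix.one_apply_ne (by rintro rfl; omega)]
    ring
  have hX1 : ∀ a b : H.Idx, (a.1 : ℕ) = b.1 + 1 → X (H.mirror b) (H.mirror a) = X a b := by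
    intro a b hab
    rw [hm, hab, Odd.neg_one_pow ⟨(b.1 : ℕ), by ring⟩]
    ring
  refine ⟨fun a b hab => (congrFun (congrFun e a) b).trans (if_neg (by omega)), fun a b hab => ?_, fun a b hab => ?_,
    fun a b hab => ?_⟩
  · rw [hz _ _ (by omega), hX _ _ hab,
      pow_apply_eq_zero hX _ _ _ (by omega)]
    ring
  · have ha := H.mirror_fst_add a
    have hb := H.mirror_fst_add b
    rw [h1 _ _ hab, h1 _ _ (by omega), hX1 _ _ hab]
  · have ha := H.mirror_fst_add a
    have hb := H.mirror_fst_add b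
    rw [h2 _ _ hab, h2 _ _ (by omega), stepMul_mirror hX1 hX1 hab, stepMul_congr hab h1 h1, hm,
      hab, Even.neg_one_pow ⟨(b.1 : ℕ) + 1, by ring⟩]
    ring

lemma mem_W_of_isTruncation {Z : H.Amb} (hZ : IsTruncation Z) : Z ∈ H.W := by
  -- The logarithm up to the second subdiagonal; the deeper blocks may be zero because the
  -- truncation forgets what they produce.
  let X : Matrix H.Idx H.Idx ℂ := fun a b =>
    if (a.1 : ℕ) = b.1 + 1 then Z a b
    else if (a.1 : ℕ) = b.1 + 2 then Z a b - H.stepMul Z Z a b / 2 else 0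
  have h1 : ∀ a b : H.Idx, (a.1 : ℕ) = b.1 + 1 → X a b = Z a b := fun a b h => if_pos h
  have h2 : ∀ a b : H.Idx, (a.1 : ℕ) = b.1 + 2 → X a b = Z a b - H.stepMul Z Z a b / 2 :=
    fun a b h => (if_neg (by omega)).trans (if_pos h)
  have h3 : ∀ a b : H.Idx, (a.1 : ℕ) ≠ b.1 + 1 → (a.1 : ℕ) ≠ b.1 + 2 → X a b = 0 :=
    fun a b h h' => (if_neg h).trans (if_neg h')
  have hX : ∀ a b : H.Idx, a.1 ≤ b.1 → X a b = 0 := fun a b h => by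
    have := Fin.le_def.1 h
    exact h3 _ _ (by omega) (by omega)
  refine ⟨_, ⟨X, (mem_gMinus_iff X).2 ⟨hX, fun a b => ?_⟩, rfl⟩, ?_⟩
  · have ha := H.mirror_fst_add a
    have hb := H.mirror_fst_add b
    by_cases c1 : (a.1 : ℕ) = b.1 + 1
    · rw [h1 _ _ c1, h1 _ _ (by omega), hZ.fst _ _ c1, c1,
        Odd.neg_one_pow ⟨(b.1 : ℕ), by ring⟩]
      ring
    by_cases c2 : (a.1 : ℕ) = b.1 + 2
    · rw [h2 _ _ c2, h2 _ _ (by omega), stepMul_mirror hZ.fst hZ.fst c2, c2,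
        Even.neg_one_pow ⟨(b.1 : ℕ) + 1, by ring⟩]
      linear_combination hZ.snd _ _ c2
    · rw [h3 _ _ c1 c2, h3 _ _ (by omega) (by omega), mul_zero]
  · funext a b
    by_cases h : (a.1 : ℕ) ≤ b.1 + 2
    · refine Eq.trans ?_ ((if_pos h).trans (exp_apply hX h)).symm
      by_cases c1 : (a.1 : ℕ) = b.1 + 1
      · rw [h1 _ _ c1, pow_apply_eq_zero hX _ _ _ (by omega),
          Matrix.one_apply_ne (by rintro rfl; omega)]
        ring
      by_cases c2 : (a.1 : ℕ) = b.1 + 2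
      · rw [h2 _ _ c2, sq_apply_eq_stepMul hX c2, stepMul_congr c2 h1 h1,
          Matrix.one_apply_ne (by rintro rfl; omega)]
        ring
      · rw [h3 _ _ c1 c2, pow_apply_eq_zero hX _ _ _ (by omega), hZ.upper _ _ (by omega)]
        ring
    · exact (hZ.far _ _ (by omega)).trans (if_neg h).symm

lemma mem_W_iff {Z : H.Amb} : Z ∈ H.W ↔ IsTruncation Z :=
  ⟨isTruncation_of_mem_W, mem_W_of_isTruncation⟩

end HodgeNumbers


namespace HodgeNumbers

variable (H : HodgeNumbers w)

@[simp] lemma dY_apply (a b : H.Idx) (Y : H.Amb) : H.dY a b Y = Y a b := rfl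

lemma contactForm_apply (a b : H.Idx) (Y U : H.Amb) :
    H.contactForm a b Y U = U a b - H.stepMul Y U a b := by
  simp only [contactForm, stepMul, sub_apply, sum_apply,
    dY_apply]
  congr 1
  refine Finset.sum_congr rfl fun c _ => ?_
  split_ifs <;> rfl

/-! ### The reduced system in arbitrary weight -/

/-- The blocks of the reduced system: `Y_{j+1,j}` for `2 j + 1 ≤ w` and `Y_{j+2,j}` for
`2 j + 2 ≤ w`. -/
abbrev HalfBlock (w i j : ℕ) : Prop := (i = j + 1 ∧ 2 * j + 1 ≤ w) ∨ (i = j + 2 ∧ 2 * j + 2 ≤ w)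

/-- For `a` in block `j + 2` and `b` in block `j`, where `2 j + 2 = w`, the `(a, b)` entry of
`dY_{j+2,j} - Y_{j+1,j}ᵗ dY_{j+1,j}`. -/
def selfDualForm (a b : H.Idx) : H.Amb → (H.Amb →L[ℂ] ℂ) :=
  fun Y => H.dY a b -
    ∑ c : H.Idx, if (c.1 : ℕ) = b.1 + 1 then Y c (H.mirror a) • H.dY c b else 0

/-- The reduced system, in weights of both parities. -/
def reduced : DiffSystem H.Amb where
  carrier := {Y | (∀ a b : H.Idx, ¬ HalfBlock w a.1 b.1 → Y a b = 0) ∧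
    (∀ a b : H.Idx, (a.1 : ℕ) = b.1 + 1 → 2 * (b.1 : ℕ) + 1 = w →
      Y (H.mirror b) (H.mirror a) = Y a b) ∧
    ∀ a b : H.Idx, (a.1 : ℕ) = b.1 + 2 → 2 * (b.1 : ℕ) + 2 = w →
      Y a b + Y (H.mirror b) (H.mirror a) =
        ∑ c : H.Idx, if (c.1 : ℕ) = b.1 + 1 then Y c (H.mirror a) * Y c b else 0}
  forms :=
    {θ | ∃ a b : H.Idx, (a.1 : ℕ) = b.1 + 2 ∧ 2 * (b.1 : ℕ) + 3 ≤ w ∧ θ = H.contactForm a b} ∪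
    {θ | ∃ a b : H.Idx, (a.1 : ℕ) = b.1 + 2 ∧ 2 * (b.1 : ℕ) + 2 = w ∧ θ = H.selfDualForm a b}

lemma selfDualForm_apply (a b : H.Idx) (Y U : H.Amb) :
    H.selfDualForm a b Y U =
      U a b - ∑ c : H.Idx, if (c.1 : ℕ) = b.1 + 1 then Y c (H.mirror a) * U c b else 0 := by
  simp only [selfDualForm, sub_apply, sum_apply, dY_apply]
  congr 1
  refine Finset.sum_congr rfl fun c _ => ?_
  split_ifs <;> rfl

/-- The projection to the blocks of the reduced system. -/
def halfProj : H.Amb →L[ℂ] H.Amb :=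
  ContinuousLinearMap.pi fun a => ContinuousLinearMap.pi fun b =>
    if HalfBlock w a.1 b.1 then H.dY a b else 0

lemma halfProj_apply (Y : H.Amb) (a b : H.Idx) :
    H.halfProj Y a b = if HalfBlock w a.1 b.1 then Y a b else 0 := by
  simp only [halfProj, ContinuousLinearMap.pi_apply]
  split_ifs <;> rfl

lemma coe_halfProj : ⇑H.halfProj = H.keep (HalfBlock w) :=
  funext fun Y => funext fun a => funext fun b => H.halfProj_apply Y a b

/-- Recover all blocks `Y_{j+1,j}` from those with `2 j + 1 ≤ w`. -/
def completeFst (Y : H.Amb) : H.Amb := fun a b =>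
  if 2 * (b.1 : ℕ) + 1 ≤ w then Y a b else Y (H.mirror b) (H.mirror a)

/-- Recover an element of `W` from its blocks in the reduced system. -/
def complete (Y : H.Amb) : H.Amb := fun a b =>
  if (a.1 : ℕ) ≤ b.1 then (1 : Matrix H.Idx H.Idx ℂ) a b
  else if (a.1 : ℕ) = b.1 + 1 then H.completeFst Y a b
  else if (a.1 : ℕ) = b.1 + 2 then
    if 2 * (b.1 : ℕ) + 2 ≤ w then Y a b
    else H.stepMul (H.completeFst Y) (H.completeFst Y) a b - Y (H.mirror b) (H.mirror a)
  else 0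

lemma differentiable_entry (a b : H.Idx) : Differentiable ℂ fun Y : H.Amb => Y a b :=
  (H.dY a b).differentiable

lemma differentiable_completeFst_entry (a b : H.Idx) :
    Differentiable ℂ fun Y : H.Amb => H.completeFst Y a b := by
  unfold completeFst
  split_ifs
  exacts [H.differentiable_entry _ _, H.differentiable_entry _ _]

lemma differentiable_stepMul {f : H.Amb → H.Amb}
    (hf : ∀ a b : H.Idx, Differentiable ℂ fun Y => f Y a b) (a b : H.Idx) :
    Differentiable ℂ fun Y : H.Amb => H.stepMul (f Y) (f Y) a b := by
  unfold stepMul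
  refine Differentiable.fun_sum fun c _ => ?_
  split_ifs
  exacts [(hf a c).mul (hf c b), differentiable_const _]

lemma differentiable_complete : Differentiable ℂ H.complete := by
  refine differentiable_pi.2 fun a => differentiable_pi.2 fun b => ?_
  unfold complete
  split_ifs
  exacts [differentiable_const _, H.differentiable_completeFst_entry _ _,
    H.differentiable_entry _ _,
    (H.differentiable_stepMul H.differentiable_completeFst_entry _ _).sub
      (H.differentiable_entry _ _), differentiable_const _]

variable {H}

lemma complete_fst (Y : H.Amb) {a b : H.Idx} (h : (a.1 : ℕ) = b.1 + 1) :
    H.complete Y a b = H.completeFst Y a b := by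
  rw [complete, if_neg (by omega), if_pos h]

lemma complete_snd_low (Y : H.Amb) {a b : H.Idx} (h : (a.1 : ℕ) = b.1 + 2)
    (h' : 2 * (b.1 : ℕ) + 2 ≤ w) : H.complete Y a b = Y a b := by
  rw [complete, if_neg (by omega), if_neg (by omega), if_pos h, if_pos h']

lemma complete_snd_high (Y : H.Amb) {a b : H.Idx} (h : (a.1 : ℕ) = b.1 + 2)
    (h' : ¬ 2 * (b.1 : ℕ) + 2 ≤ w) : H.complete Y a b =
      H.stepMul (H.completeFst Y) (H.completeFst Y) a b - Y (H.mirror b) (H.mirror a) := by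
  rw [complete, if_neg (by omega), if_neg (by omega), if_pos h, if_neg h']

/-- In the middle of an even weight, the block `U_{j+2,j+1}` is the transpose of `U_{j+1,j}`. -/
lemma stepMul_eq_of_middle {U Z : H.Amb} {a b : H.Idx} (h' : 2 * (b.1 : ℕ) + 2 = w)
    (hU : ∀ c : H.Idx, (c.1 : ℕ) = b.1 + 1 → U (H.mirror c) (H.mirror a) = U a c) :
    H.stepMul U Z a b =
      ∑ c : H.Idx, if (c.1 : ℕ) = b.1 + 1 then U c (H.mirror a) * Z c b else 0 := by
  refine Finset.sum_congr rfl fun c _ => ?_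
  split_ifs with hc
  · rw [← hU c hc, H.mirror_eq_self (by omega)]
  · rfl

/-! ### Projection and completion are mutually inverse. -/

lemma halfProj_mem {y : H.Amb} (hy : IsTruncation y) : H.halfProj y ∈ H.reduced.carrier := by
  refine ⟨fun a b h => ?_, fun a b h h' => ?_, fun a b h h' => ?_⟩ <;>
    have ha := H.mirror_fst_add a <;> have hb := H.mirror_fst_add b
  · rw [halfProj_apply, if_neg h]
  · rw [halfProj_apply, halfProj_apply, if_pos (by omega), if_pos (by omega), hy.fst _ _ h]
  · rw [halfProj_apply, halfProj_apply, if_pos (by omega), if_pos (by omega), hy.snd _ _ h,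
      stepMul_eq_of_middle h' fun c hc => hy.fst _ _ (by omega)]
    refine Finset.sum_congr rfl fun c _ => ?_
    split_ifs with hc
    · rw [halfProj_apply, halfProj_apply, if_pos (by omega), if_pos (by omega)]
    · rfl

/-- The mirror exchanges kept and recovered blocks, so away from the middle the relations hold by
construction. Only the self-mirror block needs an equation of the carrier. -/
lemma isTruncation_complete {x : H.Amb} (hx : x ∈ H.reduced.carrier) :
    IsTruncation (H.complete x) := by
  obtain ⟨-, hx1, hx2⟩ := hx
  have hc : ∀ a b : H.Idx, (a.1 : ℕ) = b.1 + 1 →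
      H.completeFst x (H.mirror b) (H.mirror a) = H.completeFst x a b := by
    intro a b h
    have ha := H.mirror_fst_add a
    have hb := H.mirror_fst_add b
    unfold completeFst
    rcases lt_trichotomy (2 * (b.1 : ℕ) + 1) w with h' | h' | h'
    · rw [if_neg (by omega), if_pos (by omega), mirror_mirror, mirror_mirror]
    · rw [if_pos (by omega), if_pos (by omega), hx1 _ _ h h']
    · rw [if_pos (by omega), if_neg (by omega)]
  refine ⟨fun a b h => ?_, fun a b h => ?_, fun a b h => ?_, fun a b h => ?_⟩ <;>
    have ha := H.mirror_fst_add a <;> have hb := H.mirror_fst_add b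
  · rw [complete, if_neg (by omega), if_neg (by omega), if_neg (by omega)]
  · rw [complete, if_pos h]
  · rw [complete_fst _ h, complete_fst _ (by omega), hc _ _ h]
  · rw [stepMul_congr h (fun a b => complete_fst x) (fun a b => complete_fst x)]
    rcases lt_trichotomy (2 * (b.1 : ℕ) + 2) w with h' | h' | h'
    · rw [complete_snd_low _ h (by omega), complete_snd_high _ (by omega) (by omega),
        stepMul_mirror hc hc h, mirror_mirror, mirror_mirror]
      ring
    · rw [complete_snd_low _ h (by omega), complete_snd_low _ (by omega) (by omega), hx2 _ _ h h',
        stepMul_eq_of_middle h' fun c hc' => hc _ _ (by omega)]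
      refine Finset.sum_congr rfl fun c _ => ?_
      split_ifs with hc'
      · rw [completeFst, completeFst, if_pos (by omega), if_pos (by omega)]
      · rfl
    · rw [complete_snd_high _ h (by omega), complete_snd_low _ (by omega) (by omega)]
      ring

lemma halfProj_complete {x : H.Amb} (hx : x ∈ H.reduced.carrier) :
    H.halfProj (H.complete x) = x := by
  funext a b
  rw [halfProj_apply]
  split_ifs with h
  · rcases h with ⟨h, h'⟩ | ⟨h, h'⟩
    · rw [complete_fst _ h, completeFst, if_pos h']
    · rw [complete_snd_low _ h h']
  · rw [hx.1 _ _ h]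

lemma complete_halfProj {y : H.Amb} (hy : IsTruncation y) : H.complete (H.halfProj y) = y := by
  have hf : ∀ a b : H.Idx, (a.1 : ℕ) = b.1 + 1 → H.completeFst (H.halfProj y) a b = y a b := by
    intro a b h
    have ha := H.mirror_fst_add a
    have hb := H.mirror_fst_add b
    unfold completeFst
    split_ifs with h'
    · rw [halfProj_apply, if_pos (by omega)]
    · rw [halfProj_apply, if_pos (by omega), hy.fst _ _ h]
  funext a b
  have ha := H.mirror_fst_add a
  have hb := H.mirror_fst_add b
  by_cases h0 : (a.1 : ℕ) ≤ b.1
  · rw [complete, if_pos h0, hy.upper _ _ h0]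
  by_cases h1 : (a.1 : ℕ) = b.1 + 1
  · rw [complete_fst _ h1, hf _ _ h1]
  by_cases h2 : (a.1 : ℕ) = b.1 + 2
  · by_cases h' : 2 * (b.1 : ℕ) + 2 ≤ w
    · rw [complete_snd_low _ h2 h', halfProj_apply, if_pos (by omega)]
    · rw [complete_snd_high _ h2 h', halfProj_apply, if_pos (by omega), stepMul_congr h2 hf hf,
        ← hy.snd _ _ h2]
      ring
  · rw [complete, if_neg h0, if_neg h1, if_neg h2, hy.far _ _ (by omega)]

/-! ### Tangent vectors of `W` and the contact forms -/

lemma tangent_fst {y u : H.Amb} (hu : IsZariskiTangent H.W y u) {a b : H.Idx}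
    (h : (a.1 : ℕ) = b.1 + 1) : u (H.mirror b) (H.mirror a) = u a b := by
  have := hu (H.dY (H.mirror b) (H.mirror a) - H.dY a b : H.Amb →L[ℂ] ℂ)
    (ContinuousLinearMap.differentiable _)
    fun z hz => sub_eq_zero.2 ((mem_W_iff.1 hz).fst _ _ h)
  rw [ContinuousLinearMap.fderiv] at this
  exact sub_eq_zero.1 this

lemma hasFDerivAt_stepMul (y : H.Amb) (a b : H.Idx) :
    HasFDerivAt (fun z : H.Amb => H.stepMul z z a b)
      (∑ c : H.Idx, if (c.1 : ℕ) = b.1 + 1 then y a c • H.dY c b + y c b • H.dY a c else 0) y := by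
  unfold stepMul
  refine HasFDerivAt.fun_sum fun c _ => ?_
  split_ifs
  exacts [(H.dY a c).hasFDerivAt.mul (H.dY c b).hasFDerivAt, hasFDerivAt_const _ _]

/-- The Leibniz rule applied to `IsTruncation.snd`. -/
lemma tangent_snd {y u : H.Amb} (hu : IsZariskiTangent H.W y u) {a b : H.Idx}
    (h : (a.1 : ℕ) = b.1 + 2) :
    u a b + u (H.mirror b) (H.mirror a) = H.stepMul y u a b + H.stepMul u y a b := by
  have hd := fun z => ((H.dY a b).hasFDerivAt.add
    (H.dY (H.mirror b) (H.mirror a)).hasFDerivAt).sub (hasFDerivAt_stepMul z a b)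
  have := hu _ (fun z => (hd z).differentiableAt)
    fun z hz => sub_eq_zero.2 ((mem_W_iff.1 hz).snd _ _ h)
  rw [(hd y).fderiv, sub_apply, sum_apply, sub_eq_zero] at this
  refine Eq.trans this ?_
  unfold stepMul
  rw [← Finset.sum_add_distrib]
  refine Finset.sum_congr rfl fun c _ => ?_
  split_ifs
  · simp only [add_apply, smul_apply, dY_apply,
      smul_eq_mul]
    ring
  · simp

/-- On `W`, the transpose of the contact form in the opposite block is the negative of the contact
form. -/
lemma contactForm_mirror {y u : H.Amb} (hy : IsTruncation y) (hu : IsZariskiTangent H.W y u)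
    {a b : H.Idx} (h : (a.1 : ℕ) = b.1 + 2) :
    H.contactForm (H.mirror b) (H.mirror a) y u = -H.contactForm a b y u := by
  -- The mirror turns `Y dY` into `dY Y`, and the two together are the differential of the product
  -- `Y Y`.
  rw [contactForm_apply, contactForm_apply,
    stepMul_mirror hy.fst (fun a b h => tangent_fst hu h) h]
  linear_combination tangent_snd hu h

/-- The bound is what keeps the factor `Y_{j+2,j+1}`, in column `j + 1`, among the blocks of the
reduced system. -/
lemma contactForm_halfProj {a b : H.Idx} (h : (a.1 : ℕ) = b.1 + 2)
    (h' : 2 * (b.1 : ℕ) + 3 ≤ w) (y u : H.Amb) :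
    H.contactForm a b (H.halfProj y) (H.halfProj u) = H.contactForm a b y u := by
  rw [contactForm_apply, contactForm_apply, halfProj_apply, if_pos (by omega)]
  congr 1
  refine Finset.sum_congr rfl fun c _ => ?_
  split_ifs with hc
  · rw [halfProj_apply, halfProj_apply, if_pos (by omega), if_pos (by omega)]
  · rfl

/-- Here `Y_{j+2,j+1}` is just beyond the kept blocks, but it is the mirror transpose of the kept
block `Y_{j+1,j}`. -/
lemma selfDualForm_halfProj {a b : H.Idx} (h : (a.1 : ℕ) = b.1 + 2)
    (h' : 2 * (b.1 : ℕ) + 2 = w) {y : H.Amb} (hy : IsTruncation y) (u : H.Amb) :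
    H.selfDualForm a b (H.halfProj y) (H.halfProj u) = H.contactForm a b y u := by
  have ha := H.mirror_fst_add a
  rw [contactForm_apply, selfDualForm_apply, halfProj_apply, if_pos (by omega),
    stepMul_eq_of_middle h' fun c hc => hy.fst _ _ (by omega)]
  congr 1
  refine Finset.sum_congr rfl fun c _ => ?_
  split_ifs with hc
  · rw [halfProj_apply, halfProj_apply, if_pos (by omega), if_pos (by omega)]
  · rfl

lemma forms_iff {y u : H.Amb} (hy : IsTruncation y) (hu : IsZariskiTangent H.W y u) :
    (∀ θ ∈ H.coupledContact.forms, θ y u = 0) ↔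
      ∀ θ ∈ H.reduced.forms, θ (H.halfProj y) (H.halfProj u) = 0 := by
  constructor
  · rintro hf θ (⟨a, b, h, h', rfl⟩ | ⟨a, b, h, h', rfl⟩)
    · rw [contactForm_halfProj h h']
      exact hf _ ⟨a, b, h, rfl⟩
    · rw [selfDualForm_halfProj h h' hy]
      exact hf _ ⟨a, b, h, rfl⟩
  · rintro hf θ ⟨a, b, h, rfl⟩
    have ha := H.mirror_fst_add a
    have hb := H.mirror_fst_add b
    rcases lt_trichotomy (2 * (b.1 : ℕ) + 2) w with h' | h' | h'
    · rw [← contactForm_halfProj h (by omega)]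
      exact hf _ (Or.inl ⟨a, b, h, by omega, rfl⟩)
    · rw [← selfDualForm_halfProj h h' hy]
      exact hf _ (Or.inr ⟨a, b, h, h', rfl⟩)
    -- Past the middle, the mirror form lies before the middle and differs only by sign.
    · rw [← neg_eq_zero, ← contactForm_mirror hy hu h,
        ← contactForm_halfProj (by omega) (by omega)]
      exact hf _ (Or.inl ⟨_, _, by omega, by omega, rfl⟩)

variable (H)

theorem inducesGermCorrespondence_reduced :
    InducesGermCorrespondence (H.keep (HalfBlock w)) H.coupledContact H.reduced := by
  rw [← coe_halfProj]
  exact inducesGermCorrespondence_of_inverse H.halfProj H.complete H.differentiable_complete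
    (fun y hy => halfProj_mem (mem_W_iff.1 hy)) (fun x hx => mem_W_iff.2 (isTruncation_complete hx))
    (fun y hy => complete_halfProj (mem_W_iff.1 hy)) (fun x hx => halfProj_complete hx)
    (fun y hy u hu => forms_iff (mem_W_iff.1 hy) hu)

lemma keep_congr {P P' : ℕ → ℕ → Prop} [DecidableRel P] [DecidableRel P']
    (h : ∀ i j, P i j ↔ P' i j) : H.keep P = H.keep P' := by
  funext Y a b
  exact if_congr (h _ _) rfl rfl

end HodgeNumbers

/-! ### Specialization to odd and even weight. -/

open HodgeNumbers

lemma oddBlock_iff (k i j : ℕ) : OddBlock k i j ↔ HalfBlock (2 * k + 1) i j := by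
  unfold OddBlock HalfBlock
  omega

lemma evenBlock_iff (k i j : ℕ) : EvenBlock k i j ↔ HalfBlock (2 * k) i j := by
  unfold EvenBlock HalfBlock
  omega

/-- For `w = 2k + 1` the condition `2j + 2 = w` has no solution, and `2j + 1 = w` means `j = k`. -/
lemma oddReduced_eq (k : ℕ) (H : HodgeNumbers (2 * k + 1)) : oddReduced k H = H.reduced := by
  unfold oddReduced reduced
  congr 1
  · ext Y
    simp only [oddBlock_iff, Set.mem_ofPred_eq]
    refine and_congr_right fun _ => ⟨fun h => ⟨fun a b h1 h2 => h a b (by omega) (by omega),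
      fun a b h1 h2 => by omega⟩, fun h a b h1 h2 => h.1 a b (by omega) (by omega)⟩
  · ext θ
    constructor
    · rintro ⟨a, b, h, h', rfl⟩
      exact Or.inl ⟨a, b, h, by omega, rfl⟩
    · rintro (⟨a, b, h, h', rfl⟩ | ⟨a, b, h, h', rfl⟩)
      · exact ⟨a, b, h, by omega, rfl⟩
      · omega

lemma middleForm_eq {k : ℕ} (H : HodgeNumbers (2 * k)) (a : H.Idx) {b : H.Idx}
    (hb : (b.1 : ℕ) + 1 = k) : middleForm k H a b = H.selfDualForm a b := by
  unfold middleForm selfDualForm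
  rw [hb]

/-- For `w = 2k` the condition `2j + 1 = w` has no solution, and `2j + 2 = w` means `j + 1 = k`,
which is impossible for `k = 0`. -/
lemma evenReduced_eq (k : ℕ) (H : HodgeNumbers (2 * k)) : evenReduced k H = H.reduced := by
  unfold evenReduced reduced
  congr 1
  · ext Y
    simp only [evenBlock_iff, Set.mem_ofPred_eq]
    refine and_congr_right fun _ => ⟨fun h => ⟨fun a b h1 h2 => by omega,
      fun a b h1 h2 => ?_⟩, fun h a b h1 h2 => ?_⟩
    · have hb : (b.1 : ℕ) + 1 = k := by omega
      rw [h a b (by omega) hb, hb]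
    · rw [h.2 a b (by omega) (by omega), h2]
  · ext θ
    constructor
    · rintro (⟨a, b, h, h', rfl⟩ | ⟨a, b, h, h', rfl⟩)
      · exact Or.inl ⟨a, b, h, by omega, rfl⟩
      · exact Or.inr ⟨a, b, by omega, by omega, middleForm_eq H a h'⟩
    · rintro (⟨a, b, h, h', rfl⟩ | ⟨a, b, h, h', rfl⟩)
      · exact Or.inl ⟨a, b, h, by omega, rfl⟩
      · exact Or.inr ⟨a, b, by omega, by omega, (middleForm_eq H a (by omega)).symm⟩

end

end ContactReduction

open ContactReduction
theorem proposition4p6 (k : ℕ) :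
    (∀ H : HodgeNumbers (2 * k + 1),
      InducesGermCorrespondence (H.keep (OddBlock k)) H.coupledContact (oddReduced k H)) ∧
    (∀ H : HodgeNumbers (2 * k),
      InducesGermCorrespondence (H.keep (EvenBlock k)) H.coupledContact (evenReduced k H)) := by
  refine ⟨fun H => ?_, fun H => ?_⟩
  · rw [oddReduced_eq, H.keep_congr (oddBlock_iff k)]
    exact H.inducesGermCorrespondence_reduced
  · rw [evenReduced_eq, H.keep_congr (evenBlock_iff k)]
    exact H.inducesGermCorrespondence_reduced
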